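/- Let $d\ge 1$ and let $\alpha=(\alpha_1,\dots,\alpha_d)\in\mathbb{R}^d$ be such that $1,\alpha_1,\dots,\alpha_d$ are linearly independent over $\mathbb{Q}$. Write $\operatorname{mes}$ for Lebesgue measure on $\mathbb{R}^d$. A bounded set $S\subset\mathbb{R}^d$ is called Riemann measurable if its boundary has measure zero. A measurable set $S\subset\mathbb{R}^d$ of finite measure is called a bounded remainder set (with respect to $\alpha$) if there is a constant $C=C(S,\alpha)$ such that, for every $n\ge 0$ and almost every $x\in\mathbb{R}^d$, $$\Big|\sum_{k=0}^{n-1}\chi_S(x+k\alpha)-n\operatorname{mes}S\Big|\le C,\qquad\text{where}\quad \chi_S(x)=\sum_{m\in\mathbb{Z}^d}\mathbf{1}_S(x+m).$$ Let $\gamma$ be a positive number of the form $\gamma=n_0+n_1\alpha_1+\cdots+n_d\alpha_d$ with integers $n_0,\dots,n_d$. Suppose that $U\subset\mathbb{R}^d$ is open, $K\subset U$ is compact, and $\operatorname{mes}K<\gamma<\operatorname{mes}U$ (where $\operatorname{mes}U=\infty$ is allowed). Then there exists a Riemann measurable bounded remainder set $S$ with $K\subset S\subset U$ and $\operatorname{mes}S=\gamma$.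 -/

import Mathlib

open MeasureTheory

namespace BoundedRemainder

noncomputable section

/-- A bounded subset of `ℝ^d` is Riemann measurable if its boundary has Lebesgue measure zero. -/
def IsRiemannMeasurable {d : ℕ} (S : Set (Fin d → ℝ)) : Prop :=
  Bornology.IsBounded S ∧ volume (frontier S) = 0

/-- The multiplicity function `χ_S(x) = ∑_{k ∈ ℤ^d} 1_S(x + k)` of the projection of `S` to the
torus `ℝ^d / ℤ^d`. (For a measurable set of finite measure the sum is finite for almost
every `x`; for a bounded set it is finite for every `x`.) -/
def torusMultiplicity {d : ℕ} (S : Set (Fin d → ℝ)) (x : Fin d → ℝ) : ℝ :=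
  ∑' k : Fin d → ℤ, S.indicator (fun _ => (1 : ℝ)) (x + fun i => (k i : ℝ))

/-- The discrepancy `D_n(S, x) = ∑_{k=0}^{n-1} χ_S(x + kα) - n mes S`. -/
def discrepancy {d : ℕ} (α : Fin d → ℝ) (S : Set (Fin d → ℝ)) (n : ℕ) (x : Fin d → ℝ) : ℝ :=
  (∑ k ∈ Finset.range n, torusMultiplicity S (x + (k : ℝ) • α)) - n * (volume S).toReal

/-- `S` is a bounded remainder set with respect to `α`: a (Lebesgue measurable) set of finite
measure whose discrepancy is bounded by a constant that depends neither on `n` nor on `x`,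
for every `n` and almost every `x`. -/
def IsBoundedRemainderSet {d : ℕ} (α : Fin d → ℝ) (S : Set (Fin d → ℝ)) : Prop :=
  NullMeasurableSet S ∧ volume S ≠ ⊤ ∧
    ∃ C : ℝ, ∀ n : ℕ, ∀ᵐ x : Fin d → ℝ, |discrepancy α S n x| ≤ C

end

end BoundedRemainder

/-!
A Riemann measurable set `S` is a bounded remainder set as soon as `χ_S - mes S` is the coboundary
of a bounded function under the rotation by `α`. This property survives cutting `S` into finitely
many pieces and translating them by vectors of `ℤ α + ℤ^d`: a translation by an integer vector
leaves `χ` unchanged, and a translation by `α` changes it by a bounded coboundary.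

Some Riemann measurable `T` of measure `γ` has this property: the union of `⌊γ⌋` unit cubes and
of the part of another unit cube where the fractional part of `n₁ x₁ + ⋯ + n_d x_d` is less than
that of `γ = n₀ + n₁ α₁ + ⋯ + n_d α_d`.

By Kronecker's theorem `ℤ α + ℤ^d` is dense, so small cubes can be moved into slightly larger ones
by its translations, and a Riemann measurable set can be moved piecewise into any open set of larger
measure. Choose a Riemann measurable `A` with `K ⊆ A`, `closure A ⊆ U` and `mes A < γ`; move `A`
into the interior of `T`, and the remaining part of `T` into `U \ closure A`. The union `S` of `A`
and the latter image lies between `K` and `U` and is obtained from `T` by piecewise translations.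
-/

namespace BoundedRemainder

noncomputable section

section Kronecker

open UnitAddTorus

local instance : MeasureSpace UnitAddCircle := ⟨AddCircle.haarAddCircle⟩

local instance : Measure.IsAddHaarMeasure (volume : Measure UnitAddCircle) :=
  inferInstanceAs (Measure.IsAddHaarMeasure AddCircle.haarAddCircle)

local instance : IsProbabilityMeasure (volume : Measure UnitAddCircle) :=
  inferInstanceAs (IsProbabilityMeasure AddCircle.haarAddCircle)

variable {ι : Type*}

/-- The group `ℤ α + ℤ^ι`, the translations that change `χ_S` by a bounded coboundary of `α`. -/
def shiftGroup (α : ι → ℝ) : AddSubgroup (ι → ℝ) :=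
  AddSubgroup.zmultiples α ⊔ ((Int.castAddHom ℝ).compLeft ι).range

lemma mem_shiftGroup {α v : ι → ℝ} :
    v ∈ shiftGroup α ↔ ∃ (q : ℤ) (m : ι → ℤ), q • α + (fun i ↦ (m i : ℝ)) = v := by
  simp only [shiftGroup, AddSubgroup.mem_sup, AddSubgroup.mem_zmultiples_iff,
    AddMonoidHom.mem_range, exists_exists_eq_and]
  rfl

lemma exists_intCast_add_eq_of_coe_eq {x y : ι → ℝ}
    (h : ∀ i, (x i : UnitAddCircle) = (y i : UnitAddCircle)) :
    ∃ m : ι → ℤ, (y + fun i ↦ (m i : ℝ)) = x := by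
  have (i : ι) : ∃ m : ℤ, y i + m = x i := by
    have hsub : ((x i - y i : ℝ) : UnitAddCircle) = 0 := by
      rw [AddCircle.coe_sub, h i, sub_self]
    obtain ⟨m, hm⟩ := (AddCircle.coe_eq_zero_iff (1 : ℝ)).1 hsub
    exact ⟨m, by simpa [eq_sub_iff_add_eq'] using hm⟩
  choose m hm using this
  exact ⟨m, funext hm⟩

variable [Fintype ι]

lemma mFourier_eq_toCircle_sum (n : ι → ℤ) (x : UnitAddTorus ι) :
    mFourier n x = AddCircle.toCircle (∑ i, n i • x i) := by
  simp only [mFourier, ContinuousMap.coe_mk, fourier_apply]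
  exact (map_prod (Circle.coeHom.comp AddCircle.toCircle_addChar.toMonoidHom)
    (fun i ↦ Multiplicative.ofAdd (n i • x i)) Finset.univ).symm

lemma mFourierCoeff_eq_zero_of_periodic {f : UnitAddTorus ι → ℂ} {a : UnitAddTorus ι}
    (hf : Function.Periodic f a) {n : ι → ℤ} (hn : ∑ i, n i • a i ≠ 0) :
    mFourierCoeff f n = 0 := by
  have mFourier_add_right (t : UnitAddTorus ι) :
      mFourier (-n) (t + a) = mFourier (-n) a * mFourier (-n) t := by
    simp [mFourier_eq_toCircle_sum, Finset.sum_add_distrib, AddCircle.toCircle_add, mul_comm]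
  have hne : mFourier (-n) a ≠ 1 := by
    rw [mFourier_eq_toCircle_sum, ← Circle.coe_one, Ne, Circle.coe_inj, ← AddCircle.toCircle_zero,
      (AddCircle.injective_toCircle one_ne_zero).eq_iff]
    simpa using hn
  have hcoeff : mFourierCoeff f n = mFourier (-n) a * mFourierCoeff f n :=
    calc mFourierCoeff f n = ∫ t, mFourier (-n) (t + a) • f (t + a) :=
          (integral_add_right_eq_self (fun t ↦ mFourier (-n) t • f t) a).symm
      _ = ∫ t, mFourier (-n) a * (mFourier (-n) t • f t) := by
          simp only [hf _, mFourier_add_right, smul_eq_mul, mul_assoc]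
      _ = mFourier (-n) a * mFourierCoeff f n := integral_const_mul _ _
  by_contra h0
  exact hne (mul_right_cancel₀ h0 (by rw [one_mul, ← hcoeff]))

lemma eq_mFourierCoeff_zero_of_periodic {f : C(UnitAddTorus ι, ℂ)} {a : UnitAddTorus ι}
    (hf : Function.Periodic f a) (ha : ∀ n : ι → ℤ, ∑ i, n i • a i = 0 → n = 0)
    (x : UnitAddTorus ι) : f x = mFourierCoeff f 0 := by
  have hcoeff (n : ι → ℤ) (hn : n ≠ 0) : mFourierCoeff f n = 0 :=
    mFourierCoeff_eq_zero_of_periodic hf (mt (ha n) hn)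
  have hsummable : Summable (mFourierCoeff f) :=
    summable_of_ne_finset_zero (s := {0}) fun n hn ↦ hcoeff n (by simpa using hn)
  rw [← (hasSum_mFourier_series_apply_of_summable hsummable x).tsum_eq,
    tsum_eq_single 0 fun n hn ↦ by rw [hcoeff n hn, zero_smul]]
  simp [mFourier_zero]

-- The distance to the subgroup is a continuous function invariant under `a`, hence constant.
theorem dense_zmultiples_of_sum_zsmul_ne_zero {a : UnitAddTorus ι}
    (ha : ∀ n : ι → ℤ, ∑ i, n i • a i = 0 → n = 0) :
    Dense (AddSubgroup.zmultiples a : Set (UnitAddTorus ι)) := by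
  let Z := AddSubgroup.zmultiples a
  let dist_Z : C(UnitAddTorus ι, ℂ) := ⟨fun x ↦ (‖(x : UnitAddTorus ι ⧸ Z)‖ : ℂ), by fun_prop⟩
  have hperiodic : Function.Periodic dist_Z a := fun x ↦ by
    have : ((x + a : UnitAddTorus ι) : UnitAddTorus ι ⧸ Z) = x :=
      QuotientAddGroup.mk_add_of_mem x (AddSubgroup.mem_zmultiples a)
    simp only [dist_Z, ContinuousMap.coe_mk, this]
  intro x
  have hconst : dist_Z x = dist_Z 0 := by
    rw [eq_mFourierCoeff_zero_of_periodic hperiodic ha x,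
      eq_mFourierCoeff_zero_of_periodic hperiodic ha 0]
  rw [← QuotientAddGroup.norm_mk_eq_zero_iff_mem_closure]
  simpa [dist_Z] using hconst

theorem dense_shiftGroup {α : ι → ℝ}
    (hα : ∀ (n : ι → ℤ) (m : ℤ), ∑ i, (n i : ℝ) * α i = m → n = 0) :
    Dense (shiftGroup α : Set (ι → ℝ)) := by
  let toTorus : (ι → ℝ) → UnitAddTorus ι := Pi.map fun _ (t : ℝ) ↦ (t : UnitAddCircle)
  have hopen : IsOpenMap toTorus := IsOpenMap.piMap (fun _ ↦ QuotientAddGroup.isOpenMap_coe)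
    (Filter.Eventually.of_forall fun _ ↦ QuotientAddGroup.mk_surjective)
  have hindep (n : ι → ℤ) (hn : ∑ i, n i • toTorus α i = 0) : n = 0 := by
    have : ((∑ i, (n i : ℝ) * α i : ℝ) : UnitAddCircle) = 0 := by
      rw [← hn]
      simp only [toTorus, Pi.map_apply, ← AddCircle.coe_zsmul, zsmul_eq_mul]
      exact map_sum (QuotientAddGroup.mk' _) _ _
    obtain ⟨m, hm⟩ := AddCircle.coe_eq_zero_iff (1 : ℝ) |>.1 this
    exact hα n m (by simpa using hm.symm)
  refine ((dense_zmultiples_of_sum_zsmul_ne_zero hindep).preimage hopen).mono ?_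
  rintro x ⟨q, hq⟩
  obtain ⟨m, hm⟩ := exists_intCast_add_eq_of_coe_eq (x := x) (y := q • α) fun i ↦
    (congrFun hq i).symm
  exact mem_shiftGroup.2 ⟨q, m, hm⟩

lemma eq_zero_of_linearIndependent_cons_one {d : ℕ} {α : Fin d → ℝ}
    (hα : LinearIndependent ℚ (Fin.cons 1 α : Fin (d + 1) → ℝ)) (n : Fin d → ℤ) (m : ℤ)
    (h : ∑ i, (n i : ℝ) * α i = m) : n = 0 := by
  have hcoeff := Fintype.linearIndependent_iff.1 hα (Fin.cons (-(m : ℚ)) fun i ↦ (n i : ℚ)) (by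
    simp [Fin.sum_univ_succ, Rat.smul_def, h])
  exact funext fun i ↦ by simpa using hcoeff i.succ

open BoxIntegral.unitPartition in
lemma setIntegral_unitBox_comp_add_right {F : (ι → ℝ) → ℝ}
    (hF : ∀ m : ι → ℤ, Function.Periodic F fun i ↦ (m i : ℝ)) (v : ι → ℝ) :
    ∫ x in (box 1 (0 : ι → ℤ) : Set (ι → ℝ)), F (x + v) =
      ∫ x in (box 1 (0 : ι → ℤ) : Set (ι → ℝ)), F x := by
  let toTorus (x : ι → ℝ) : UnitAddTorus ι := fun i ↦ (x i : UnitAddCircle)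
  have toTorus_surjective : Function.Surjective toTorus := fun y ↦
    ⟨fun i ↦ (y i).out, funext fun i ↦ (y i).out_eq'⟩
  let f (y : UnitAddTorus ι) : ℝ := F (Function.surjInv toTorus_surjective y)
  have f_toTorus (x : ι → ℝ) : f (toTorus x) = F x := by
    obtain ⟨m, hm⟩ := exists_intCast_add_eq_of_coe_eq
      (congrFun (Function.surjInv_eq toTorus_surjective (toTorus x)))
    rw [← hF m x, hm]
  have integral_eq (w : ι → ℝ) :
      ∫ x in (box 1 (0 : ι → ℤ) : Set (ι → ℝ)), F (x + w) = ∫ y, f (y + toTorus w) := by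
    rw [UnitAddTorus.integral_preimage _ 0]
    have hbox : (box 1 (0 : ι → ℤ) : Set (ι → ℝ)) =
        {x | ∀ i, x i ∈ Set.Ioc ((0 : ι → ℝ) i) ((0 : ι → ℝ) i + 1)} := by
      ext x
      simp
    rw [hbox]
    exact integral_congr_ae (.of_forall fun x ↦ (f_toTorus (x + w)).symm)
  have integral_eq_zero := (integral_eq 0).trans (integral_add_right_eq_self f (toTorus 0))
  rw [integral_eq v, integral_add_right_eq_self, ← integral_eq_zero]
  simp only [add_zero]

end Kronecker

section Coboundary

variable {X : Type*} [AddCommGroup X] {a : X} {f : X → ℝ}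

/-- The bounded coboundaries of the translation by `a`: the functions `h - h (· + a)` with `h`
bounded. Their Birkhoff sums telescope, hence are bounded. -/
def boundedCoboundaries (a : X) : AddSubgroup (X → ℝ) where
  carrier := {f | ∃ h : X → ℝ, (∃ C, ∀ x, |h x| ≤ C) ∧ ∀ x, f x = h x - h (x + a)}
  zero_mem' := ⟨0, ⟨0, by simp⟩, by simp⟩
  add_mem' := by
    rintro f f' ⟨h, ⟨C, hC⟩, hf⟩ ⟨h', ⟨C', hC'⟩, hf'⟩
    refine ⟨h + h', ⟨C + C', fun x ↦ ?_⟩, fun x ↦ ?_⟩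
    · exact (abs_add_le _ _).trans (add_le_add (hC x) (hC' x))
    · simp only [Pi.add_apply, hf, hf']
      ring
  neg_mem' := by
    rintro f ⟨h, ⟨C, hC⟩, hf⟩
    refine ⟨-h, ⟨C, by simpa using hC⟩, fun x ↦ ?_⟩
    simp only [Pi.neg_apply, hf]
    ring

lemma exists_abs_sum_range_le_of_mem_boundedCoboundaries (hf : f ∈ boundedCoboundaries a) :
    ∃ C, ∀ (n : ℕ) (x : X), |∑ k ∈ Finset.range n, f (x + k • a)| ≤ C := by
  obtain ⟨h, ⟨C, hC⟩, hf⟩ := hf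
  refine ⟨C + C, fun n x ↦ ?_⟩
  have telescope : ∑ k ∈ Finset.range n, f (x + k • a) = h x - h (x + n • a) := by
    simpa [hf, add_assoc, ← succ_nsmul] using
      Finset.sum_range_sub' (fun k ↦ h (x + k • a)) n
  rw [telescope]
  exact (abs_sub _ _).trans (add_le_add (hC _) (hC _))

lemma comp_add_zsmul_sub_mem_boundedCoboundaries (hf : ∃ C, ∀ x, |f x| ≤ C) (q : ℤ) :
    (fun x ↦ f (x + q • a) - f x) ∈ boundedCoboundaries a := by
  obtain ⟨C, hC⟩ := hf
  have shift_mem (q : ℤ) :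
      (fun x ↦ f (x + q • a) - f (x + (q + 1) • a)) ∈ boundedCoboundaries a :=
    ⟨fun x ↦ f (x + q • a), ⟨C, fun _ ↦ hC _⟩, fun x ↦ by
      simp [add_one_zsmul, add_assoc, add_comm a]⟩
  induction q with
  | zero => exact ⟨0, ⟨0, by simp⟩, by simp⟩
  | succ q ih =>
    convert sub_mem ih (shift_mem q) using 1
    ext x
    simp
  | pred q ih =>
    convert add_mem ih (shift_mem (-q - 1)) using 1
    ext x
    simp

end Coboundary

namespace IsRiemannMeasurable

variable {d : ℕ} {A B : Set (Fin d → ℝ)}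

lemma nullMeasurableSet (hA : IsRiemannMeasurable A) : NullMeasurableSet A :=
  nullMeasurableSet_of_null_frontier hA.2

lemma volume_ne_top (hA : IsRiemannMeasurable A) : volume A ≠ ⊤ := hA.1.measure_lt_top.ne

lemma union (hA : IsRiemannMeasurable A) (hB : IsRiemannMeasurable B) :
    IsRiemannMeasurable (A ∪ B) :=
  ⟨hA.1.union hB.1, measure_mono_null ((frontier_union_subset A B).trans
    (Set.union_subset_union Set.inter_subset_left Set.inter_subset_right))
    (measure_union_null hA.2 hB.2)⟩

lemma inter (hA : IsRiemannMeasurable A) (hB : IsRiemannMeasurable B) :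
    IsRiemannMeasurable (A ∩ B) :=
  ⟨hA.1.subset Set.inter_subset_left, null_frontier_inter hA.2 hB.2⟩

lemma sdiff (hA : IsRiemannMeasurable A) (hB : IsRiemannMeasurable B) :
    IsRiemannMeasurable (A \ B) :=
  ⟨hA.1.subset Set.sdiff_subset,
    null_frontier_inter hA.2 ((congrArg _ (frontier_compl B)).trans hB.2)⟩

lemma biUnion {κ : Type*} (I : Finset κ) {P : κ → Set (Fin d → ℝ)}
    (hP : ∀ k ∈ I, IsRiemannMeasurable (P k)) : IsRiemannMeasurable (⋃ k ∈ I, P k) := by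
  classical
  induction I using Finset.induction_on with
  | empty => simp [IsRiemannMeasurable]
  | insert k I _ ih =>
    rw [Finset.set_biUnion_insert]
    exact (hP k (I.mem_insert_self k)).union (ih fun l hl ↦ hP l (Finset.mem_insert_of_mem hl))

lemma iUnion {κ : Type*} [Finite κ] {P : κ → Set (Fin d → ℝ)}
    (hP : ∀ k, IsRiemannMeasurable (P k)) : IsRiemannMeasurable (⋃ k, P k) := by
  have := Fintype.ofFinite κ
  simpa using biUnion Finset.univ fun k _ ↦ hP k

lemma volume_closure (hA : IsRiemannMeasurable A) : volume (closure A) = volume A :=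
  measure_congr (closure_ae_eq_of_null_frontier hA.2)

lemma volume_interior (hA : IsRiemannMeasurable A) : volume (interior A) = volume A :=
  measure_congr (interior_ae_eq_of_null_frontier hA.2)

lemma preimage_add_right (hA : IsRiemannMeasurable A) (v : Fin d → ℝ) :
    IsRiemannMeasurable ((· + v) ⁻¹' A) := by
  refine ⟨(isometry_add_right v).antilipschitz.isBounded_preimage hA.1, ?_⟩
  have hfrontier : (· + v) ⁻¹' frontier A = frontier ((· + v) ⁻¹' A) :=
    (Homeomorph.addRight v).preimage_frontier A
  rw [← hfrontier, measure_preimage_add_right, hA.2]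

lemma isBoundedRemainderSet {α : Fin d → ℝ} (hA : IsRiemannMeasurable A)
    (hχ : (fun x ↦ torusMultiplicity A x - (volume A).toReal) ∈ boundedCoboundaries α) :
    IsBoundedRemainderSet α A := by
  obtain ⟨C, hC⟩ := exists_abs_sum_range_le_of_mem_boundedCoboundaries hχ
  refine ⟨hA.nullMeasurableSet, hA.volume_ne_top, C, fun n ↦ .of_forall fun x ↦ ?_⟩
  simpa [discrepancy, Nat.cast_smul_eq_nsmul] using hC n x

lemma of_convex (hbdd : Bornology.IsBounded A) (hA : Convex ℝ A) : IsRiemannMeasurable A :=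
  ⟨hbdd, hA.addHaar_frontier volume⟩

end IsRiemannMeasurable

section Index

open BoxIntegral.unitPartition

variable {ι : Type*}

lemma finite_image_index [Finite ι] {A : Set (ι → ℝ)} (hA : Bornology.IsBounded A) (n : ℕ) :
    (index n '' A).Finite := by
  classical
  have := Fintype.ofFinite ι
  have index_mono : Monotone (index n : (ι → ℝ) → ι → ℤ) := fun x y hxy i ↦
    sub_le_sub_right (Int.ceil_mono (mul_le_mul_of_nonneg_left (hxy i) n.cast_nonneg)) 1
  exact (index_mono.map_bddBelow hA.bddBelow).finite_of_bddAbove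
    (index_mono.map_bddAbove hA.bddAbove)

lemma index_one_add_intCast (x : ι → ℝ) (m : ι → ℤ) :
    index 1 (x + fun i ↦ (m i : ℝ)) = index 1 x + m := by
  ext i
  simp only [index_apply, Nat.cast_one, one_mul, Pi.add_apply, Int.ceil_add_intCast]
  ring

end Index

section Multiplicity

open BoxIntegral.unitPartition

variable {d : ℕ} {A : Set (Fin d → ℝ)}

lemma torusMultiplicity_eq_sum {I : Finset (Fin d → ℤ)} (hI : ∀ y ∈ A, index 1 y ∈ I)
    (x : Fin d → ℝ) :
    torusMultiplicity A x =
      ∑ ν ∈ I, A.indicator (fun _ ↦ (1 : ℝ)) (x + fun i ↦ (((ν - index 1 x) i : ℤ) : ℝ)) := by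
  rw [torusMultiplicity, ← (Equiv.subRight (index 1 x)).tsum_eq]
  refine tsum_eq_sum fun ν hν ↦ Set.indicator_of_notMem (fun hmem ↦ hν ?_) _
  have hindex := hI _ hmem
  rwa [index_one_add_intCast, Equiv.subRight_apply, add_sub_cancel] at hindex

lemma exists_abs_torusMultiplicity_le (hA : Bornology.IsBounded A) :
    ∃ C, ∀ x, |torusMultiplicity A x| ≤ C := by
  let I := (finite_image_index hA 1).toFinset
  refine ⟨I.card, fun x ↦ ?_⟩
  rw [torusMultiplicity_eq_sum (I := I) fun y hy ↦
    (Set.Finite.mem_toFinset _).2 (Set.mem_image_of_mem _ hy)]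
  refine (Finset.abs_sum_le_sum_abs _ _).trans ((Finset.sum_le_card_nsmul _ _ 1 fun ν _ ↦ ?_).trans
    (by simp))
  rw [← Real.norm_eq_abs]
  exact (norm_indicator_le_norm_self _ _).trans_eq norm_one

lemma torusMultiplicity_iUnion {κ : Type*} [Fintype κ] {P : κ → Set (Fin d → ℝ)}
    (hP : ∀ k, Bornology.IsBounded (P k)) (hdisj : Pairwise (Function.onFun Disjoint P))
    (x : Fin d → ℝ) : torusMultiplicity (⋃ k, P k) x = ∑ k, torusMultiplicity (P k) x := by
  classical
  let I := (finite_image_index (Bornology.isBounded_iUnion.2 hP) 1).toFinset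
  have hI : ∀ y ∈ ⋃ k, P k, index 1 y ∈ I := fun y hy ↦
    (Set.Finite.mem_toFinset _).2 (Set.mem_image_of_mem _ hy)
  rw [torusMultiplicity_eq_sum hI, Finset.sum_congr rfl fun k _ ↦
    torusMultiplicity_eq_sum (fun y hy ↦ hI y (Set.mem_iUnion_of_mem k hy)) x, Finset.sum_comm]
  refine Finset.sum_congr rfl fun ν _ ↦ ?_
  simpa using congrFun (Finset.indicator_biUnion Finset.univ P
    (f := fun _ ↦ (1 : ℝ)) fun k _ l _ hkl ↦ hdisj hkl) _

lemma torusMultiplicity_preimage_add_right (A : Set (Fin d → ℝ)) (v x : Fin d → ℝ) :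
    torusMultiplicity ((· + v) ⁻¹' A) x = torusMultiplicity A (x + v) := by
  simp only [torusMultiplicity, add_right_comm x v]
  rfl

lemma torusMultiplicity_add_intCast (A : Set (Fin d → ℝ)) (x : Fin d → ℝ) (m : Fin d → ℤ) :
    torusMultiplicity A (x + fun i ↦ (m i : ℝ)) = torusMultiplicity A x := by
  rw [torusMultiplicity, torusMultiplicity, ← (Equiv.addLeft m).tsum_eq
    fun k ↦ A.indicator _ (x + fun i ↦ (k i : ℝ))]
  refine tsum_congr fun k ↦ congrArg _ ?_
  ext i
  simp [add_assoc]

lemma torusMultiplicity_biUnion_box_inter {I : Finset (Fin d → ℤ)}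
    {P : (Fin d → ℤ) → Set (Fin d → ℝ)}
    (hP : ∀ ν (m : Fin d → ℤ) x, (x + fun i ↦ (m i : ℝ)) ∈ P ν ↔ x ∈ P ν) (x : Fin d → ℝ) :
    torusMultiplicity (⋃ ν ∈ I, (box 1 ν : Set (Fin d → ℝ)) ∩ P ν) x =
      ∑ ν ∈ I, (P ν).indicator (fun _ ↦ (1 : ℝ)) x := by
  classical
  rw [torusMultiplicity_eq_sum (I := I)]
  · refine Finset.sum_congr rfl fun ν hν ↦ ?_
    refine Set.indicator_eq_indicator ?_ rfl
    simp only [Set.mem_iUnion, Set.mem_inter_iff, BoxIntegral.Box.mem_coe, mem_box_iff_index,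
      index_one_add_intCast, add_sub_cancel, hP]
    simp [hν]
  · simp only [Set.mem_iUnion, Set.mem_inter_iff, BoxIntegral.Box.mem_coe, mem_box_iff_index]
    rintro y ⟨ν, hν, rfl, -⟩
    exact hν

lemma torusMultiplicity_preimage_sub_mem_boundedCoboundaries {α v : Fin d → ℝ}
    (hv : v ∈ shiftGroup α) (hA : Bornology.IsBounded A) :
    (fun x ↦ torusMultiplicity ((· + v) ⁻¹' A) x - torusMultiplicity A x) ∈
      boundedCoboundaries α := by
  obtain ⟨q, m, rfl⟩ := mem_shiftGroup.1 hv
  simp only [torusMultiplicity_preimage_add_right]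
  simpa only [← add_assoc, torusMultiplicity_add_intCast] using
    comp_add_zsmul_sub_mem_boundedCoboundaries (exists_abs_torusMultiplicity_le hA) q

end Multiplicity

section Equidecomposition

variable {d : ℕ}

/-- `A` can be cut into finitely many Riemann measurable pieces which reassemble to `B` after
translations by elements of `G`. The translation of the `k`-th piece by `-v k` is written as a
preimage under `x ↦ x + v k`. -/
def RiemannEquidecomposable (G : AddSubgroup (Fin d → ℝ)) (A B : Set (Fin d → ℝ)) : Prop :=
  ∃ (κ : Type) (_ : Fintype κ) (P : κ → Set (Fin d → ℝ)) (v : κ → G),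
    (∀ k, IsRiemannMeasurable (P k)) ∧
    Pairwise (Function.onFun Disjoint P) ∧
    Pairwise (Function.onFun Disjoint fun k ↦ (· + (v k : Fin d → ℝ)) ⁻¹' P k) ∧
    A = ⋃ k, P k ∧ B = ⋃ k, (· + (v k : Fin d → ℝ)) ⁻¹' P k

namespace RiemannEquidecomposable

variable {G : AddSubgroup (Fin d → ℝ)} {A B A' B' : Set (Fin d → ℝ)}

lemma symm (h : RiemannEquidecomposable G A B) : RiemannEquidecomposable G B A := by
  obtain ⟨κ, _, P, v, hP, hdisj, hdisj', hA, hB⟩ := h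
  have translate_back (k : κ) :
      (· + ((-v k : G) : Fin d → ℝ)) ⁻¹' ((· + (v k : Fin d → ℝ)) ⁻¹' P k) = P k := by
    ext x
    simp
  refine ⟨κ, ‹_›, fun k ↦ (· + (v k : Fin d → ℝ)) ⁻¹' P k, fun k ↦ -v k,
    fun k ↦ (hP k).preimage_add_right _, hdisj', ?_, hB, ?_⟩
  · simpa only [translate_back] using hdisj
  · simpa only [translate_back] using hA

lemma union (h : RiemannEquidecomposable G A B) (h' : RiemannEquidecomposable G A' B')
    (hA : Disjoint A A') (hB : Disjoint B B') :
    RiemannEquidecomposable G (A ∪ A') (B ∪ B') := by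
  obtain ⟨κ, _, P, v, hP, hdisj, hdisj', rfl, rfl⟩ := h
  obtain ⟨κ', _, P', v', hP', hdisjP', hdisjP'', rfl, rfl⟩ := h'
  simp only [Set.disjoint_iUnion_left, Set.disjoint_iUnion_right] at hA hB
  refine ⟨κ ⊕ κ', inferInstance, Sum.elim P P', Sum.elim v v', ?_, ?_, ?_, ?_, ?_⟩
  · rintro (k | k)
    exacts [hP k, hP' k]
  · rintro (k | k) (l | l) hkl
    exacts [hdisj (by simpa using hkl), hA l k, (hA k l).symm, hdisjP' (by simpa using hkl)]
  · rintro (k | k) (l | l) hkl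
    exacts [hdisj' (by simpa using hkl), hB l k, (hB k l).symm, hdisjP'' (by simpa using hkl)]
  · simp [Set.iUnion_sum]
  · simp [Set.iUnion_sum]

lemma isRiemannMeasurable_left (h : RiemannEquidecomposable G A B) : IsRiemannMeasurable A := by
  obtain ⟨κ, _, P, v, hP, -, -, rfl, -⟩ := h
  exact IsRiemannMeasurable.iUnion hP

lemma isRiemannMeasurable_right (h : RiemannEquidecomposable G A B) : IsRiemannMeasurable B :=
  h.symm.isRiemannMeasurable_left

lemma volume_eq (h : RiemannEquidecomposable G A B) : volume A = volume B := by
  obtain ⟨κ, _, P, v, hP, hdisj, hdisj', rfl, rfl⟩ := h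
  rw [measure_iUnion₀ (hdisj.mono fun _ _ ↦ Disjoint.aedisjoint) fun k ↦ (hP k).nullMeasurableSet,
    measure_iUnion₀ (hdisj'.mono fun _ _ ↦ Disjoint.aedisjoint)
      fun k ↦ ((hP k).preimage_add_right _).nullMeasurableSet]
  simp only [measure_preimage_add_right]

lemma torusMultiplicity_sub_mem_boundedCoboundaries {α : Fin d → ℝ}
    (h : RiemannEquidecomposable (shiftGroup α) A B) :
    (fun x ↦ torusMultiplicity B x - torusMultiplicity A x) ∈ boundedCoboundaries α := by
  obtain ⟨κ, _, P, v, hP, hdisj, hdisj', rfl, rfl⟩ := h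
  convert sum_mem fun k (_ : k ∈ Finset.univ) ↦
    torusMultiplicity_preimage_sub_mem_boundedCoboundaries (v k).2 (hP k).1 using 1
  ext x
  rw [torusMultiplicity_iUnion (fun k ↦ ((hP k).preimage_add_right _).1) hdisj',
    torusMultiplicity_iUnion (fun k ↦ (hP k).1) hdisj, Finset.sum_apply, Finset.sum_sub_distrib]

lemma isBoundedRemainderSet {α : Fin d → ℝ} (h : RiemannEquidecomposable (shiftGroup α) A B)
    (hA : (fun x ↦ torusMultiplicity A x - (volume A).toReal) ∈ boundedCoboundaries α) :
    IsBoundedRemainderSet α B := by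
  refine h.isRiemannMeasurable_right.isBoundedRemainderSet ?_
  rw [← h.volume_eq]
  convert add_mem h.torusMultiplicity_sub_mem_boundedCoboundaries hA using 1
  ext x
  simp

end RiemannEquidecomposable

end Equidecomposition

section Packing

open BoxIntegral.unitPartition Filter

variable {ι : Type*}

lemma volume_real_biUnion_box [Fintype ι] (n : ℕ) [NeZero n] (I : Finset (ι → ℤ)) :
    volume.real (⋃ ν ∈ I, (box n ν : Set (ι → ℝ))) = I.card / n ^ Fintype.card ι := by
  rw [measureReal_biUnion_finset (fun _ _ _ _ hne ↦ disjoint.1 hne)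
    (fun ν _ ↦ (box n ν).measurableSet_coe)
    fun ν _ ↦ (box n ν).isBounded.measure_lt_top.ne]
  simp [measureReal_def, div_eq_mul_inv]

lemma eventually_exists_box_cover [Finite ι] {K W : Set (ι → ℝ)} (hK : IsCompact K) (hW : IsOpen W)
    (hKW : K ⊆ W) : ∀ᶠ n : ℕ in atTop, ∃ I : Finset (ι → ℤ),
      K ⊆ ⋃ ν ∈ I, (box (n + 1) ν : Set (ι → ℝ)) ∧
        ⋃ ν ∈ I, (box (n + 1) ν : Set (ι → ℝ)) ⊆ W := by
  have := Fintype.ofFinite ι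
  obtain ⟨δ, hδ, hsub⟩ := hK.exists_thickening_subset_open hW hKW
  filter_upwards [tendsto_one_div_add_atTop_nhds_zero_nat.eventually_lt_const hδ] with n hn
  refine ⟨(finite_image_index hK.isBounded (n + 1)).toFinset, fun x hx ↦ ?_, fun y hy ↦ hsub ?_⟩
  · simp only [Set.Finite.mem_toFinset, Set.mem_iUnion, BoxIntegral.Box.mem_coe, mem_box_iff_index]
    exact ⟨_, Set.mem_image_of_mem _ hx, rfl⟩
  · simp only [Set.Finite.mem_toFinset, Set.mem_iUnion, BoxIntegral.Box.mem_coe] at hy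
    obtain ⟨_, ⟨x, hx, rfl⟩, hy⟩ := hy
    refine Metric.mem_thickening_iff.2 ⟨x, hx, ?_⟩
    have hxbox : x ∈ box (n + 1) (index (n + 1) x) := mem_box_iff_index.2 rfl
    calc dist y x ≤ Metric.diam (BoxIntegral.Box.Icc (box (n + 1) (index (n + 1) x))) :=
          Metric.dist_le_diam_of_mem (BoxIntegral.Box.isBounded_Icc _)
            (BoxIntegral.Box.coe_subset_Icc hy) (BoxIntegral.Box.coe_subset_Icc hxbox)
      _ ≤ 1 / (n + 1 : ℕ) := diam_boxIcc (n + 1) _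
      _ < δ := by simpa using hn

lemma eventually_mul_add_two_pow_lt {a b : ℝ} (hab : a < b) (d : ℕ) :
    ∀ᶠ n : ℕ in atTop, a * (n + 2 : ℝ) ^ d < b * (n + 1 : ℝ) ^ d := by
  have hlim : Tendsto (fun n : ℕ ↦ a * (1 + 1 / ((n : ℝ) + 1)) ^ d) atTop (nhds a) := by
    simpa using ((tendsto_one_div_add_atTop_nhds_zero_nat.const_add 1).pow d).const_mul a
  filter_upwards [hlim.eventually_lt_const hab] with n hn
  have hratio : (n + 2 : ℝ) = (1 + 1 / ((n : ℝ) + 1)) * (n + 1) := by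
    field_simp
    ring
  rw [hratio, mul_pow, ← mul_assoc]
  gcongr

lemma exists_box_cover_card_le [Fintype ι] {L W K V : Set (ι → ℝ)} (hL : IsCompact L)
    (hW : IsOpen W) (hLW : L ⊆ W) (hK : IsCompact K) (hV : IsOpen V) (hKV : K ⊆ V)
    (hWK : volume W < volume K) :
    ∃ (n : ℕ) (I J : Finset (ι → ℤ)), L ⊆ ⋃ ν ∈ I, (box (n + 2) ν : Set (ι → ℝ)) ∧
      ⋃ ν ∈ J, (box (n + 1) ν : Set (ι → ℝ)) ⊆ V ∧ I.card ≤ J.card := by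
  have hWK' : volume.real W < volume.real K :=
    ENNReal.toReal_strict_mono hK.measure_lt_top.ne hWK
  obtain ⟨n, ⟨⟨I, hLI, hIW⟩, J, hKJ, hJV⟩, hn⟩ :=
    (((tendsto_add_atTop_nat 1).eventually (eventually_exists_box_cover hL hW hLW)).and
      (eventually_exists_box_cover hK hV hKV)).and
        (eventually_mul_add_two_pow_lt hWK' (Fintype.card ι)) |>.exists
  refine ⟨n, I, J, hLI, hJV, ?_⟩
  have hI := measureReal_mono hIW hWK.ne_top
  have hJ := measureReal_mono hKJ (μ := volume) ((measure_biUnion_lt_top J.finite_toSet fun ν _ ↦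
    (BoxIntegral.Box.isBounded _).measure_lt_top).ne)
  rw [volume_real_biUnion_box, div_le_iff₀ (by positivity)] at hI
  rw [volume_real_biUnion_box, le_div_iff₀ (by positivity)] at hJ
  have hIJ : (I.card : ℝ) < J.card := by
    push_cast [add_assoc, one_add_one_eq_two] at hI hJ
    exact hI.trans_lt (hn.trans_le hJ)
  exact_mod_cast hIJ.le

lemma exists_preimage_add_right_box_subset [Finite ι] {G : AddSubgroup (ι → ℝ)}
    (hG : Dense (G : Set (ι → ℝ))) {M N : ℕ} [NeZero M] [NeZero N] (hNM : N < M) (μ ν : ι → ℤ) :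
    ∃ v : G, (· + (v : ι → ℝ)) ⁻¹' (box M μ : Set (ι → ℝ)) ⊆ box N ν := by
  have hwidth : (1 / M : ℝ) < 1 / N :=
    one_div_lt_one_div_of_lt (by simp [Nat.pos_of_neZero]) (by exact_mod_cast hNM)
  obtain ⟨v, hv, hvG⟩ := hG.exists_mem_open (U := Set.univ.pi fun i ↦
      Set.Ioo ((μ i + 1) / M - (ν i + 1) / N : ℝ) (μ i / M - ν i / N))
    (isOpen_set_pi Set.finite_univ fun _ _ ↦ isOpen_Ioo)
    (Set.univ_pi_nonempty_iff.2 fun i ↦ Set.nonempty_Ioo.2 (by simp only [add_div]; linarith))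
  refine ⟨⟨v, hv⟩, fun x hx ↦ mem_box_iff.2 fun i ↦ ?_⟩
  have hxi := mem_box_iff.1 hx i
  have hvi := hvG i (Set.mem_univ i)
  simp only [Pi.add_apply, Set.mem_Ioo] at hxi hvi
  constructor <;> linarith

lemma convex_coe_box (B : BoxIntegral.Box ι) : Convex ℝ (B : Set (ι → ℝ)) := by
  rw [BoxIntegral.Box.coe_eq_pi]
  exact convex_pi fun i _ ↦ convex_Ioc _ _

lemma IsRiemannMeasurable.coe_box {d : ℕ} (B : BoxIntegral.Box (Fin d)) :
    IsRiemannMeasurable (B : Set (Fin d → ℝ)) := .of_convex B.isBounded (convex_coe_box B)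

theorem exists_subset_riemannEquidecomposable {d : ℕ} {G : AddSubgroup (Fin d → ℝ)}
    (hG : Dense (G : Set (Fin d → ℝ))) {R V : Set (Fin d → ℝ)} (hR : IsRiemannMeasurable R)
    (hV : IsOpen V) (hRV : volume R < volume V) : ∃ R' ⊆ V, RiemannEquidecomposable G R R' := by
  obtain ⟨K, hKV, hK, hRK⟩ := hV.exists_lt_isCompact hRV
  obtain ⟨W, hRW, hW, hWK⟩ := (closure R).exists_isOpen_lt_of_lt _ (hR.volume_closure.trans_lt hRK)
  obtain ⟨n, I, J, hRI, hJV, hIJ⟩ :=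
    exists_box_cover_card_le hR.1.isCompact_closure hW hRW hK hV hKV hWK
  obtain ⟨f⟩ : Nonempty (I ↪ J) := Function.Embedding.nonempty_of_card_le (by simpa using hIJ)
  choose v hv using fun ν : I ↦
    exists_preimage_add_right_box_subset hG (n + 1).lt_succ_self (ν : Fin d → ℤ) (f ν)
  let P (ν : I) : Set (Fin d → ℝ) := R ∩ box (n + 2) (ν : Fin d → ℤ)
  have piece_subset (ν : I) : (· + (v ν : Fin d → ℝ)) ⁻¹' P ν ⊆ box (n + 1) (f ν : Fin d → ℤ) :=
    (Set.preimage_mono Set.inter_subset_right).trans (hv ν)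
  have hR_eq : R = ⋃ ν, P ν := by
    simp only [P, Set.iUnion_subtype, ← Set.inter_iUnion, Set.left_eq_inter]
    exact subset_closure.trans hRI
  refine ⟨_, Set.iUnion_subset fun ν ↦ (piece_subset ν).trans
    ((Set.subset_biUnion_of_mem (f ν).2).trans hJV), I, inferInstance, P, v,
    fun ν ↦ hR.inter (.coe_box _), fun ν ν' hne ↦ ?_, fun ν ν' hne ↦ ?_, hR_eq, rfl⟩
  · exact (disjoint.1 (Subtype.coe_injective.ne hne)).mono Set.inter_subset_right
      Set.inter_subset_right
  · exact (disjoint.1 (Subtype.coe_injective.ne (f.injective.ne hne))).mono (piece_subset ν)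
      (piece_subset ν')

lemma exists_isRiemannMeasurable_between {d : ℕ} {K U : Set (Fin d → ℝ)} (hK : IsCompact K)
    (hU : IsOpen U) (hKU : K ⊆ U) {c : ENNReal} (hc : volume K < c) :
    ∃ A, IsRiemannMeasurable A ∧ K ⊆ A ∧ closure A ⊆ U ∧ volume A < c := by
  obtain ⟨W, hKW, hW, hWc⟩ := K.exists_isOpen_lt_of_lt c hc
  obtain ⟨V, hV, hKV, hVU, -⟩ := exists_open_between_and_isCompact_closure hK (hU.inter hW)
    (Set.subset_inter hKU hKW)
  obtain ⟨n, I, hKI, hIV⟩ := (eventually_exists_box_cover hK hV hKV).exists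
  have hclosure := (closure_mono hIV).trans hVU
  exact ⟨_, .biUnion I fun ν _ ↦ .coe_box _, hKI, hclosure.trans Set.inter_subset_left,
    (measure_mono ((subset_closure.trans hclosure).trans Set.inter_subset_right)).trans_lt hWc⟩

end Packing

section ModelSet

open BoxIntegral.unitPartition

variable {ι : Type*} [Fintype ι]

/-- The linear form with integer coefficients `n`. It is defined on `ℝ^ι`, and its fractional part
on the torus. -/
def intForm (n : ι → ℤ) : (ι → ℝ) →ₗ[ℝ] ℝ := ∑ i, (n i : ℝ) • LinearMap.proj i

lemma intForm_apply (n : ι → ℤ) (x : ι → ℝ) : intForm n x = ∑ i, (n i : ℝ) * x i := by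
  simp [intForm]

lemma continuous_intForm (n : ι → ℤ) : Continuous (intForm n) :=
  LinearMap.continuous_of_finiteDimensional _

lemma fract_intForm_add_intCast (n : ι → ℤ) (x : ι → ℝ) (m : ι → ℤ) :
    Int.fract (intForm n (x + fun i ↦ (m i : ℝ))) = Int.fract (intForm n x) := by
  have hint : intForm n (fun i ↦ (m i : ℝ)) = ((∑ i, n i * m i : ℤ) : ℝ) := by
    rw [intForm_apply]
    push_cast
    rfl
  rw [map_add, hint, Int.fract_add_intCast]

/-- The `ℤ^ι`-periodic set of the points at which the integer form with coefficients `n` has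
fractional part less than `r`. Its part in a unit cube is the non-integral part of the model
bounded remainder set. -/
def strip (n : ι → ℤ) (r : ℝ) : Set (ι → ℝ) := {x | Int.fract (intForm n x) < r}

lemma measurableSet_strip (n : ι → ℤ) (r : ℝ) : MeasurableSet (strip n r) :=
  measurableSet_lt (measurable_fract.comp (continuous_intForm n).measurable) measurable_const

lemma add_intCast_mem_strip_iff (n m : ι → ℤ) (r : ℝ) (x : ι → ℝ) :
    (x + fun i ↦ (m i : ℝ)) ∈ strip n r ↔ x ∈ strip n r := by
  simp only [strip, Set.mem_ofPred_eq, fract_intForm_add_intCast]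

lemma indicator_fract_lt_fract (y s : ℝ) :
    {t : ℝ | Int.fract t < Int.fract s}.indicator (fun _ ↦ (1 : ℝ)) y =
      Int.fract s + (Int.fract (y - s) - Int.fract y) := by
  have hy := Int.floor_add_fract y
  have hs := Int.floor_add_fract s
  by_cases h : Int.fract y < Int.fract s
  · have hsub : Int.fract (y - s) = Int.fract y - Int.fract s + 1 := by
      refine Int.fract_eq_iff.2 ⟨?_, by linarith, ⌊y⌋ - ⌊s⌋ - 1, by push_cast; linarith⟩
      linarith [Int.fract_nonneg y, Int.fract_lt_one s]
    rw [Set.indicator_of_mem (by exact h), hsub]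
    ring
  · have hsub : Int.fract (y - s) = Int.fract y - Int.fract s := by
      refine Int.fract_eq_iff.2 ⟨by linarith, ?_, ⌊y⌋ - ⌊s⌋, by push_cast; linarith⟩
      linarith [Int.fract_lt_one y, Int.fract_nonneg s]
    rw [Set.indicator_of_notMem (by exact h), hsub]
    ring

lemma indicator_strip {α : ι → ℝ} {γ : ℝ} {n₀ : ℤ} {n : ι → ℤ} (hγ : γ = n₀ + intForm n α)
    (x : ι → ℝ) : (strip n (Int.fract γ)).indicator (fun _ ↦ (1 : ℝ)) x =
      Int.fract γ + (Int.fract (intForm n (x - α)) - Int.fract (intForm n x)) := by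
  have hsub : Int.fract (intForm n x - γ) = Int.fract (intForm n (x - α)) := by
    rw [map_sub, hγ, add_comm (n₀ : ℝ), ← sub_sub, Int.fract_sub_intCast]
  rw [← hsub]
  exact indicator_fract_lt_fract (intForm n x) γ

lemma indicator_strip_sub_mem_boundedCoboundaries {α : ι → ℝ} {γ : ℝ} {n₀ : ℤ} {n : ι → ℤ}
    (hγ : γ = n₀ + intForm n α) :
    (fun x ↦ (strip n (Int.fract γ)).indicator (fun _ ↦ (1 : ℝ)) x - Int.fract γ) ∈
      boundedCoboundaries α := by
  refine ⟨fun x ↦ Int.fract (intForm n (x - α)), ⟨1, fun x ↦ ?_⟩, fun x ↦ ?_⟩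
  · rw [Int.abs_fract]
    exact (Int.fract_lt_one _).le
  · simp only [indicator_strip hγ, add_sub_cancel_left, add_sub_cancel_right]

lemma volume_real_unitBox_inter {P : Set (ι → ℝ)} (hP : MeasurableSet P) {g : (ι → ℝ) → ℝ}
    (hg : Measurable g) (hg_bdd : ∃ C, ∀ x, |g x| ≤ C)
    (hg_periodic : ∀ m : ι → ℤ, Function.Periodic g fun i ↦ (m i : ℝ)) {a : ι → ℝ} {c : ℝ}
    (hPg : ∀ x, P.indicator (fun _ ↦ (1 : ℝ)) x = c + (g x - g (x + a))) :
    volume.real ((box 1 (0 : ι → ℤ) : Set (ι → ℝ)) ∩ P) = c := by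
  obtain ⟨C, hC⟩ := hg_bdd
  have volume_box : volume (box 1 (0 : ι → ℤ) : Set (ι → ℝ)) = 1 := by simp
  have hint {f : (ι → ℝ) → ℝ} (hf : Measurable f) (hf_bdd : ∀ x, |f x| ≤ C) :
      IntegrableOn f (box 1 (0 : ι → ℤ) : Set (ι → ℝ)) :=
    Measure.integrableOn_of_bounded (volume_box.trans_ne ENNReal.one_ne_top)
      hf.aestronglyMeasurable (.of_forall hf_bdd)
  have hg_int := hint hg hC
  have hg_int' : IntegrableOn (fun x ↦ g (x + a)) (box 1 (0 : ι → ℤ) : Set (ι → ℝ)) :=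
    hint (hg.comp (measurable_add_const a)) fun x ↦ hC (x + a)
  have hsub_int : IntegrableOn (fun x ↦ g x - g (x + a)) (box 1 (0 : ι → ℤ) : Set (ι → ℝ)) :=
    hg_int.sub hg_int'
  have hc_int : IntegrableOn (fun _ ↦ c) (box 1 (0 : ι → ℤ) : Set (ι → ℝ)) :=
    integrableOn_const (volume_box.trans_ne ENNReal.one_ne_top)
  calc volume.real ((box 1 (0 : ι → ℤ) : Set (ι → ℝ)) ∩ P)
      = ∫ x in (box 1 (0 : ι → ℤ) : Set (ι → ℝ)), P.indicator (fun _ ↦ (1 : ℝ)) x := by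
        rw [integral_indicator_const _ hP, measureReal_restrict_apply hP, Set.inter_comm,
          smul_eq_mul, mul_one]
    _ = ∫ x in (box 1 (0 : ι → ℤ) : Set (ι → ℝ)), (c + (g x - g (x + a))) := by simp only [hPg]
    _ = c + ((∫ x in (box 1 (0 : ι → ℤ) : Set (ι → ℝ)), g x) -
          ∫ x in (box 1 (0 : ι → ℤ) : Set (ι → ℝ)), g (x + a)) := by
        rw [integral_add hc_int hsub_int, integral_sub hg_int hg_int',
          setIntegral_const, measureReal_def, volume_box, ENNReal.toReal_one, one_smul]
    _ = c := by rw [setIntegral_unitBox_comp_add_right hg_periodic, sub_self, add_zero]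

lemma volume_real_unitBox_inter_strip {α : ι → ℝ} {γ : ℝ} {n₀ : ℤ} {n : ι → ℤ}
    (hγ : γ = n₀ + intForm n α) :
    volume.real ((box 1 (0 : ι → ℤ) : Set (ι → ℝ)) ∩ strip n (Int.fract γ)) = Int.fract γ := by
  refine volume_real_unitBox_inter (measurableSet_strip n _)
    (g := fun x ↦ Int.fract (intForm n (x - α))) (a := α) ?_ ⟨1, fun x ↦ ?_⟩ (fun m x ↦ ?_)
    fun x ↦ ?_
  · exact measurable_fract.comp
      ((continuous_intForm n).measurable.comp (measurable_sub_const α))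
  · rw [Int.abs_fract]
    exact (Int.fract_lt_one _).le
  · simp only [add_sub_right_comm, fract_intForm_add_intCast]
  · rw [indicator_strip hγ, add_sub_cancel_right]

-- `A ∩ strip n r` is the union of the convex sets `{x ∈ A | z ≤ intForm n x < z + min r 1}` over
-- the finitely many integers `z` between the bounds of `intForm n` on `A`.
lemma isRiemannMeasurable_inter_strip {d : ℕ} {A : Set (Fin d → ℝ)}
    (hA : Bornology.IsBounded A) (hconvex : Convex ℝ A) (n : Fin d → ℤ) (r : ℝ) :
    IsRiemannMeasurable (A ∩ strip n r) := by
  let slab (z : ℤ) : Set (Fin d → ℝ) :=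
    A ∩ intForm n ⁻¹' (Set.Ico (z : ℝ) (z + 1) ∩ Set.Iio (z + r))
  have floors_finite : ((fun x ↦ ⌊intForm n x⌋) '' A).Finite := by
    have hbdd : Bornology.IsBounded (intForm n '' A) :=
      (LinearMap.toContinuousLinearMap (intForm n)).lipschitz.isBounded_image hA
    rw [← Set.image_image Int.floor]
    exact (Int.floor_mono.map_bddBelow hbdd.bddBelow).finite_of_bddAbove
      (Int.floor_mono.map_bddAbove hbdd.bddAbove)
  have slabs_cover : A ∩ strip n r = ⋃ z ∈ floors_finite.toFinset, slab z := by
    ext x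
    simp only [slab, strip, Set.mem_inter_iff, Set.mem_iUnion, Set.mem_ofPred_eq,
      Set.mem_preimage, Set.mem_Ico, Set.mem_Iio, ← Int.floor_eq_iff, Set.Finite.mem_toFinset,
      exists_prop]
    constructor
    · rintro ⟨hxA, hx⟩
      exact ⟨_, Set.mem_image_of_mem _ hxA, hxA, rfl, sub_lt_iff_lt_add'.1 hx⟩
    · rintro ⟨_, -, hxA, rfl, hx⟩
      exact ⟨hxA, sub_lt_iff_lt_add'.2 hx⟩
  rw [slabs_cover]
  refine .biUnion _ fun z _ ↦ .of_convex (hA.subset Set.inter_subset_left) (hconvex.inter ?_)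
  exact ((convex_Ico _ _).inter (convex_Iio _)).linear_preimage (intForm n)

theorem exists_volume_eq_and_torusMultiplicity_sub_mem_boundedCoboundaries {d : ℕ} [NeZero d]
    {α : Fin d → ℝ} {γ : ℝ} (hγ_nonneg : 0 ≤ γ) {n₀ : ℤ} {n : Fin d → ℤ}
    (hγ : γ = n₀ + intForm n α) :
    ∃ T, IsRiemannMeasurable T ∧ volume T = ENNReal.ofReal γ ∧
      (fun x ↦ torusMultiplicity T x - γ) ∈ boundedCoboundaries α := by
  obtain ⟨I, hI, hcard⟩ :=
    (Set.finite_singleton (0 : Fin d → ℤ)).infinite_compl.exists_subset_card_eq ⌊γ⌋₊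
  have hI_zero : (0 : Fin d → ℤ) ∉ I := fun h ↦ hI h rfl
  have hγI : γ = Int.fract γ + I.card := by
    rw [hcard, natCast_floor_eq_intCast_floor hγ_nonneg, Int.fract_add_floor]
  let P (ν : Fin d → ℤ) : Set (Fin d → ℝ) := if ν = 0 then strip n (Int.fract γ) else Set.univ
  have P_zero : P 0 = strip n (Int.fract γ) := if_pos rfl
  have P_of_mem {ν : Fin d → ℤ} (hν : ν ∈ I) : P ν = Set.univ :=
    if_neg (ne_of_mem_of_not_mem hν hI_zero)
  have P_periodic (ν m : Fin d → ℤ) (x : Fin d → ℝ) :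
      (x + fun i ↦ (m i : ℝ)) ∈ P ν ↔ x ∈ P ν := by
    by_cases hν : ν = 0 <;> simp [P, hν, add_intCast_mem_strip_iff]
  have hpiece (ν : Fin d → ℤ) : IsRiemannMeasurable ((box 1 ν : Set (Fin d → ℝ)) ∩ P ν) := by
    by_cases hν : ν = 0
    · simpa only [P, hν, if_true] using
        isRiemannMeasurable_inter_strip (BoxIntegral.Box.isBounded _) (convex_coe_box _) n _
    · simpa only [P, hν, if_false, Set.inter_univ] using .coe_box _
  have hT : IsRiemannMeasurable (⋃ ν ∈ insert 0 I, (box 1 ν : Set (Fin d → ℝ)) ∩ P ν) :=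
    .biUnion _ fun ν _ ↦ hpiece ν
  refine ⟨_, hT, ?_, ?_⟩
  · rw [← ENNReal.ofReal_toReal hT.volume_ne_top, ← measureReal_def,
      measureReal_biUnion_finset₀ (fun ν _ ν' _ hne ↦ ((disjoint.1 hne).mono
        Set.inter_subset_left Set.inter_subset_left).aedisjoint)
        (fun ν _ ↦ (hpiece ν).nullMeasurableSet) fun ν _ ↦ (hpiece ν).volume_ne_top,
      Finset.sum_insert hI_zero, P_zero, volume_real_unitBox_inter_strip hγ,
      Finset.sum_congr rfl fun ν hν ↦ by rw [P_of_mem hν, Set.inter_univ]]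
    simp [measureReal_def, ← hγI]
  · convert indicator_strip_sub_mem_boundedCoboundaries hγ using 1
    ext x
    rw [torusMultiplicity_biUnion_box_inter P_periodic, Finset.sum_insert hI_zero, P_zero,
      Finset.sum_congr rfl fun ν hν ↦ by rw [P_of_mem hν, Set.indicator_univ],
      Finset.sum_const, nsmul_one]
    linear_combination -hγI

end ModelSet

lemma dim_ne_zero_of_ofReal_lt_volume {d : ℕ} {γ : ℝ} {n₀ : ℤ} {n : Fin d → ℤ} {α : Fin d → ℝ}
    (hγ_pos : 0 < γ) (hγ : γ = n₀ + intForm n α) {U : Set (Fin d → ℝ)}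
    (hγU : ENNReal.ofReal γ < volume U) : d ≠ 0 := by
  rintro rfl
  have volume_le_one : volume U ≤ 1 := (measure_mono U.subset_univ).trans (by simp [volume_pi])
  have hγ_lt_one : γ < 1 := by simpa using hγU.trans_le volume_le_one
  obtain rfl : γ = n₀ := by simpa [intForm_apply] using hγ
  have hn₀_pos : 0 < n₀ := by exact_mod_cast hγ_pos
  have hn₀_lt_one : n₀ < 1 := by exact_mod_cast hγ_lt_one
  omega

theorem RiemannEquidecomposable.exists_between {d : ℕ} {G : AddSubgroup (Fin d → ℝ)}
    (hG : Dense (G : Set (Fin d → ℝ))) {T K U : Set (Fin d → ℝ)} (hT : IsRiemannMeasurable T)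
    (hK : IsCompact K) (hU : IsOpen U) (hKU : K ⊆ U) (hKT : volume K < volume T)
    (hTU : volume T < volume U) :
    ∃ S, K ⊆ S ∧ S ⊆ U ∧ RiemannEquidecomposable G T S := by
  obtain ⟨A, hA, hKA, hAU, hAT⟩ := exists_isRiemannMeasurable_between hK hU hKU hKT
  obtain ⟨A', hA'T, hAA'⟩ := exists_subset_riemannEquidecomposable hG hA isOpen_interior
    (hAT.trans_eq hT.volume_interior.symm)
  replace hA'T : A' ⊆ T := hA'T.trans interior_subset
  have hA' := hAA'.isRiemannMeasurable_right
  have volume_remainders_lt : volume (T \ A') < volume (U \ closure A) := by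
    rw [measure_sdiff hA'T hA'.nullMeasurableSet hA'.volume_ne_top, ← hAA'.volume_eq,
      measure_sdiff hAU isClosed_closure.nullMeasurableSet
        (hA.volume_closure.trans_ne hA.volume_ne_top), hA.volume_closure]
    exact (ENNReal.sub_lt_iff_lt_right hA.volume_ne_top hAT.le).2
      (hTU.trans_eq (tsub_add_cancel_of_le (hAT.trans hTU).le).symm)
  obtain ⟨R, hRU, hR⟩ := exists_subset_riemannEquidecomposable hG (hT.sdiff hA')
    (hU.sdiff isClosed_closure) volume_remainders_lt
  have hdisj : Disjoint A R := Set.disjoint_sdiff_right.mono subset_closure hRU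
  refine ⟨A ∪ R, hKA.trans Set.subset_union_left, Set.union_subset (subset_closure.trans hAU)
    (hRU.trans Set.sdiff_subset), ?_⟩
  rw [← Set.union_sdiff_cancel hA'T]
  exact hAA'.symm.union hR Set.disjoint_sdiff_right hdisj

end

end BoundedRemainder

theorem mainTheorem6 (d : ℕ) (α : Fin d → ℝ)
    (hα : LinearIndependent ℚ (Fin.cons 1 α : Fin (d + 1) → ℝ))
    (γ : ℝ) (hγ_pos : 0 < γ)
    (hγ : ∃ (n₀ : ℤ) (n : Fin d → ℤ), γ = n₀ + ∑ i, (n i : ℝ) * α i)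
    (K U : Set (Fin d → ℝ)) (hK : IsCompact K) (hU : IsOpen U) (hKU : K ⊆ U)
    (hKγ : volume K < ENNReal.ofReal γ) (hγU : ENNReal.ofReal γ < volume U) :
    ∃ S : Set (Fin d → ℝ),
      BoundedRemainder.IsRiemannMeasurable S ∧
      BoundedRemainder.IsBoundedRemainderSet α S ∧
      K ⊆ S ∧ S ⊆ U ∧ volume S = ENNReal.ofReal γ := by
  obtain ⟨n₀, n, hγ⟩ := hγ
  rw [← BoundedRemainder.intForm_apply] at hγ
  have : NeZero d := ⟨BoundedRemainder.dim_ne_zero_of_ofReal_lt_volume hγ_pos hγ hγU⟩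
  obtain ⟨T, hT, hTγ, hTχ⟩ :=
    BoundedRemainder.exists_volume_eq_and_torusMultiplicity_sub_mem_boundedCoboundaries hγ_pos.le hγ
  have hdense : Dense (BoundedRemainder.shiftGroup α : Set (Fin d → ℝ)) :=
    BoundedRemainder.dense_shiftGroup (BoundedRemainder.eq_zero_of_linearIndependent_cons_one hα)
  rw [← hTγ] at hKγ hγU
  obtain ⟨S, hKS, hSU, hTS⟩ :=
    BoundedRemainder.RiemannEquidecomposable.exists_between hdense hT hK hU hKU hKγ hγU
  refine ⟨S, hTS.isRiemannMeasurable_right, hTS.isBoundedRemainderSet ?_, hKS, hSU,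
    hTS.volume_eq.symm.trans hTγ⟩
  rwa [hTγ, ENNReal.toReal_ofReal hγ_pos.le]
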